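/- \textbf{Theorem 3 (expander-based construction).} Let $t\ge 0$, $r\ge 0$ be integers. \emph{The graph.} Let $G=(V\cup C,E)$ be a bipartite graph with $|V|=n$, in which every vertex of $V$ has degree $t$ and every vertex of $C$ has degree $r+1$ (so $|C|=\frac{nt}{r+1}$), and with $\mathrm{girth}(G)>4$. For $S\subseteq V$ let $\Gamma(S)\subseteq C$ be the set of vertices joined to $S$. $G$ is a $(t,r+1,\alpha,t\gamma)$-expander if $|\Gamma(S)|>t\gamma|S|$ for all nonempty $S\subseteq V$ with $|S|\le\alpha n$. \emph{The code.} Let $\mathbf H_E$ be the $|C|\times n$ matrix over $\mathbb F_q$ whose $(j,i)$ entry is nonzero exactly when $c_j$ and $v_i$ are adjacent, the nonzero entries being chosen independently and uniformly from $\mathbb F_q\setminus\{0\}$; let $\mathcal C_E=\{x\in\mathbb F_q^n:\mathbf H_Ex=0\}$, $n_G=\dim\mathcal C_E$, and let $A$ be an $n_G\times n$ generator matrix of $\mathcal C_E$. Let $\mathbb F_{q^m}\supseteq\mathbb F_q$, let $\alpha_1,\dots,\alpha_{n_G}\in\mathbb F_{q^m}$ be linearly independent over $\mathbb F_q$ and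 let $1\le k\le n_G$. The Gabidulin code $\mathcal C_G$ consists of the words $(f(\alpha_1),\dots,f(\alpha_{n_G}))$ with $f(x)=\sum_{i=0}^{k-1}a_ix^{q^i}$, $a_i\in\mathbb F_{q^m}$, and $\mathcal C_G\diamondsuit\mathcal C_E=\{gA: g\in\mathcal C_G\}\subseteq\mathbb F_{q^m}^n$. Let $R$ be its rate (dimension over $\mathbb F_{q^m}$ divided by $n$) and $\delta$ its relative minimum distance (minimum distance divided by $n$). \emph{The claim.} For sufficiently large $n$ and $q$, with high probability over the choice of $\mathbf H_E$, \[ R\ \ge\ 1-\frac t{r+1}-\max\{\delta(1-t\gamma),0\}-o(1), \] where $\gamma$ is any expansion parameter of $G$ at level $\delta-o(1)$. Precisely: for every $\varepsilon>0$ there are $\eta>0$ and $N,Q$ such that for all $n\ge N$, all prime powers $q\ge Q$ and all $G$ as above, with probability at least $1-\varepsilon$ over the choice of $\mathbf H_E$ the following holds simultaneously for all $m$, $A$, $\alpha_1,\dots,\alpha_{n_G}$ and $k$ as above and all real $\gamma$: if $G$ is a $(t,r+1,\delta-\eta,t\gamma)$-expander, then \[ R\ \ge\ 1-\frac t{r+1}-\max\{\delta(1-t\gamma),0\}-\varepsilon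 . \] -/

import Mathlib

universe u v

noncomputable section

/-- A bipartite graph with vertex classes `V = Fin n` and `C = Fin c`, in which every vertex of `V`
has degree `t` and every vertex of `C` has degree `s` (so that `c * s = n * t`). -/
structure IsBiregularBipartite {n c : ℕ} (G : SimpleGraph (Fin n ⊕ Fin c)) (t s : ℕ) : Prop where
  bipartite : G.IsBipartiteWith (Set.range Sum.inl) (Set.range Sum.inr)
  degree_left : ∀ i : Fin n, (G.neighborSet (Sum.inl i)).ncard = t
  degree_right : ∀ j : Fin c, (G.neighborSet (Sum.inr j)).ncard = s

/-- `Γ(S)`: the vertices of `C` that are joined to some vertex of `S ⊆ V`. -/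
def neighbours {n c : ℕ} (G : SimpleGraph (Fin n ⊕ Fin c)) (S : Finset (Fin n)) : Set (Fin c) :=
  {j | ∃ i ∈ S, G.Adj (Sum.inl i) (Sum.inr j)}

/-- Expansion: every nonempty `S ⊆ V` with `|S| ≤ α n` satisfies `|Γ(S)| > κ |S|`. -/
def IsExpander {n c : ℕ} (G : SimpleGraph (Fin n ⊕ Fin c)) (α κ : ℝ) : Prop :=
  ∀ S : Finset (Fin n), S.Nonempty → (S.card : ℝ) ≤ α * n →
    κ * S.card < ((neighbours G S).ncard : ℝ)

open Classical in
/-- The matrix whose `(j, i)` entry is the weight of the edge between `i ∈ V` and `j ∈ C`, and `0`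
if there is no such edge. -/
def parityCheck {n c : ℕ} {F : Type u} [Field F] (G : SimpleGraph (Fin n ⊕ Fin c))
    (w : G.edgeSet → Fˣ) : Matrix (Fin c) (Fin n) F :=
  Matrix.of fun j i =>
    if h : s(Sum.inl i, Sum.inr j) ∈ G.edgeSet then (w ⟨s(Sum.inl i, Sum.inr j), h⟩ : F) else 0

/-- The code over `F` with parity-check matrix `parityCheck G w`. -/
def expanderCode {n c : ℕ} {F : Type u} [Field F] (G : SimpleGraph (Fin n ⊕ Fin c))
    (w : G.edgeSet → Fˣ) : Submodule F (Fin n → F) :=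
  LinearMap.ker (parityCheck G w).mulVecLin

/-- The rows of `A` form a basis of the code `D`. -/
def IsGeneratorMatrix {n l : ℕ} {F : Type u} [Field F] (A : Matrix (Fin l) (Fin n) F)
    (D : Submodule F (Fin n → F)) : Prop :=
  LinearIndependent F A.row ∧ Submodule.span F (Set.range A.row) = D

/-- The Gabidulin encoder: the coefficients `a` of the linearized polynomial
`f(x) = ∑ i < k, a i * x ^ (q ^ i)`, where `q = |F|`, are mapped to the word of the values of `f`
at the points `p 0, …, p (l - 1)`. -/
def gabidulinEncode (F : Type u) {L : Type v} [Field L] {l : ℕ} (p : Fin l → L) (k : ℕ) :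
    (Fin k → L) →ₗ[L] (Fin l → L) where
  toFun a j := ∑ i : Fin k, a i * p j ^ (Nat.card F ^ (i : ℕ))
  map_add' a b := by
    funext j
    simp [add_mul, Finset.sum_add_distrib]
  map_smul' x a := by
    funext j
    simp [Finset.mul_sum, mul_assoc]

/-- The Gabidulin code followed by the code over `F` with generator matrix `A`: the words
`g * A`, for `g` in the Gabidulin code with points `p` and polynomials of `q`-degree `< k`. -/
def gabidulinThen {F : Type u} {L : Type v} [Field F] [Field L] [Algebra F L] {n l : ℕ}
    (p : Fin l → L) (k : ℕ) (A : Matrix (Fin l) (Fin n) F) : Submodule L (Fin n → L) :=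
  (LinearMap.range (gabidulinEncode F p k)).map (A.map (algebraMap F L)).vecMulLinear

open Classical in
/-- The minimum distance of a (nonzero) linear code. -/
def minDistance {L : Type v} [Field L] {n : ℕ} (D : Submodule L (Fin n → L)) : ℕ :=
  sInf {d | ∃ x ∈ D, x ≠ 0 ∧ hammingNorm x = d}

/-- The rate (dimension divided by length) of a linear code. -/
def codeRate {L : Type v} [Field L] {n : ℕ} (D : Submodule L (Fin n → L)) : ℝ :=
  (Module.finrank L D : ℝ) / n

/-- The relative minimum distance (minimum distance divided by length) of a linear code. -/
def relDistance {L : Type v} [Field L] {n : ℕ} (D : Submodule L (Fin n → L)) : ℝ :=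
  (minDistance D : ℝ) / n

/-- The probability of `A` under the uniform distribution on the finite set `Ω`. On a set
`Ω = (ι → X)` of functions this is the law of independent, uniform values in `X`. -/
def uniformProb {Ω : Type u} (A : Set Ω) : ℝ :=
  (A.ncard : ℝ) / Nat.card Ω

end

/-!
Let `q` be the size of `F`, let `D` be the expander code and `l` its dimension, so that
`l ≥ n - c = n (1 - t / (r + 1))`; the composite code has dimension `k`. Let `d` be its minimum
distance, and `T` the support of a word `g A` of weight `d`. The word `g` comes from a nonzero
linearized polynomial of `q`-degree less than `k`, which vanishes on the `F`-space spanned by the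
combinations of the points given by the columns of `A` outside `T`. As the polynomial has at most
`q ^ (k - 1)` roots, these columns have rank less than `k`; hence `k ≥ l + 1 - dim D(T)`, where
`D(T)` consists of the words of `D` supported in `T` (`IsGeneratorMatrix.exists_card_eq_minDistance`).
The rate bound therefore amounts to `dim D(T) ≤ max (d (1 - t γ)) 0 + ε n`.

By expansion, every `S ⊆ T` satisfies `|S| ≤ |Γ(S)| + K`, where `K` is about
`max (d (1 - t γ)) 0 + η n` (`IsExpander.card_le_ncard_neighbours_add`). By Hall's theorem with
deficiency, `T` contains a set `T'` that can be matched into `C` and misses at most `K` elements of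
`T`, so that `dim D(T) ≤ K + dim D(T')`.

It remains to bound `dim D(T')` by `ε n / 2` for all matchable `T'` simultaneously. The dimension is
at most the corank of the square submatrix of the parity-check matrix on `T'` and its partners.
Exposing the weights of the matching edges one at a time, the corank grows by at most one in each
step, and it grows for at most one of the `q - 1` values of the weight. So the mean of
`(q - 1) ^ corank` is at most `2 ^ |T'|` (`sum_card_pow_finrank_le`). By Markov's inequality and a
union bound over the at most `2 ^ n` sets `T'`, the probability of failure is at most
`4 ^ n / (q - 1) ^ (ε n / 2)`, which is small as soon as `q` exceeds a constant depending on `ε`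
only.
-/

/-! ### Degree counting and matchings with deficiency -/

theorem IsBiregularBipartite.card_mul_eq {n c t s : ℕ} {G : SimpleGraph (Fin n ⊕ Fin c)}
    (hG : IsBiregularBipartite G t s) : c * s = n * t := by
  classical
  have key := Finset.sum_card_bipartiteAbove_eq_sum_card_bipartiteBelow
    (s := (Finset.univ : Finset (Fin n))) (t := (Finset.univ : Finset (Fin c)))
    (fun i j => G.Adj (Sum.inl i) (Sum.inr j))
  have hl : ∀ i : Fin n, (Finset.bipartiteAbove (fun i j => G.Adj (Sum.inl i) (Sum.inr j))
      (Finset.univ : Finset (Fin c)) i).card = t := by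
    intro i
    rw [← hG.degree_left i, ← Set.ncard_coe_finset,
      ← Set.ncard_image_of_injective _ (Sum.inr_injective (α := Fin n))]
    congr 1
    ext x
    have := hG.bipartite.mem_of_adj (v := Sum.inl i) (w := x)
    cases x <;> simp_all [Finset.bipartiteAbove]
  have hr : ∀ j : Fin c, (Finset.bipartiteBelow (fun i j => G.Adj (Sum.inl i) (Sum.inr j))
      (Finset.univ : Finset (Fin n)) j).card = s := by
    intro j
    rw [← hG.degree_right j, ← Set.ncard_coe_finset,
      ← Set.ncard_image_of_injective _ (Sum.inl_injective (β := Fin c))]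
    congr 1
    ext x
    have := hG.bipartite.mem_of_adj (v := Sum.inr j) (w := x)
    cases x <;> simp_all [Finset.bipartiteBelow, G.adj_comm]
  simp only [hl, hr, Finset.sum_const, Finset.card_univ, Fintype.card_fin, smul_eq_mul] at key
  exact key.symm

/-- Hall's theorem with deficiency: `K` extra vertices joined to all of `T` reduce it to Hall's
marriage theorem, and `T'` consists of the vertices that are not matched to an extra one. -/
theorem exists_matching_of_card_le_card_biUnion_add {α β : Type*} [DecidableEq α] [DecidableEq β]
    (T : Finset α) (N : α → Finset β) (K : ℕ)
    (h : ∀ S ⊆ T, S.card ≤ (S.biUnion N).card + K) :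
    ∃ T' ⊆ T, T.card ≤ T'.card + K ∧
      ∃ f : T' → β, Function.Injective f ∧ ∀ i : T', f i ∈ N i := by
  have hall := (Finset.all_card_le_biUnion_card_iff_exists_injective
    (fun i : T => (N i).disjSum (Finset.univ : Finset (Fin K)))).1 (by
      intro S
      rcases S.eq_empty_or_nonempty with rfl | hS
      · simp
      have h1 := h (S.map (Function.Embedding.subtype _)) (by
        intro x hx
        obtain ⟨y, -, rfl⟩ := Finset.mem_map.1 hx
        exact y.2)
      rw [Finset.card_map] at h1
      refine h1.trans ?_
      have h2 : (S.biUnion fun i : T => (N i).disjSum (Finset.univ : Finset (Fin K)))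
          = ((S.map (Function.Embedding.subtype _)).biUnion N).disjSum Finset.univ := by
        obtain ⟨a, ha⟩ := hS
        ext x
        cases x
        · simp
        · simp only [Finset.mem_biUnion, Finset.inr_mem_disjSum, Finset.mem_univ, and_true, iff_true]
          exact ⟨a, ha⟩
      rw [h2, Finset.card_disjSum, Finset.card_univ, Fintype.card_fin])
  obtain ⟨g, hg, hgN⟩ := hall
  let P : Finset T := Finset.univ.filter fun i => (g i).isLeft
  have hmem : ∀ i : P.map (Function.Embedding.subtype _), ∃ j, ∃ hi : (i : α) ∈ T,
      g ⟨i, hi⟩ = Sum.inl j := by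
    rintro ⟨i, hi⟩
    obtain ⟨y, hy, rfl⟩ := Finset.mem_map.1 hi
    obtain ⟨j, hj⟩ := Sum.isLeft_iff.1 (Finset.mem_filter.1 hy).2
    exact ⟨j, y.2, hj⟩
  choose f hf hfg using hmem
  refine ⟨P.map (Function.Embedding.subtype _), ?_, ?_, f, ?_, ?_⟩
  · intro x hx
    obtain ⟨y, -, rfl⟩ := Finset.mem_map.1 hx
    exact y.2
  · have hc : (Finset.univ.filter fun i : T => ¬ (g i).isLeft).card ≤ K := by
      have hK : ((Finset.univ : Finset (Fin K)).map (Function.Embedding.inr (α := β))).card = K := by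
        simp
      rw [← Finset.card_image_of_injective _ hg]
      refine (Finset.card_le_card ?_).trans hK.le
      intro x hx
      obtain ⟨y, hy, rfl⟩ := Finset.mem_image.1 hx
      have := (Finset.mem_filter.1 hy).2
      cases hgy : g y <;> simp_all
    have := Finset.card_filter_add_card_filter_not (s := (Finset.univ : Finset T))
      (fun i => (g i).isLeft = true)
    rw [Finset.card_map]
    simp only [Finset.card_univ, Fintype.card_coe] at this
    change T.card ≤ (Finset.univ.filter fun i : T => (g i).isLeft = true).card + K
    omega
  · intro i j hij
    have : g ⟨i, hf i⟩ = g ⟨j, hf j⟩ := by rw [hfg, hfg, hij]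
    exact Subtype.ext (by simpa using hg this)
  · intro i
    have := hgN ⟨i, hf i⟩
    rw [hfg] at this
    simpa using this

/-! ### Dimensions of subspaces cut out by functionals -/

/-- Imposing the vanishing of `|S|` linear functionals lowers the dimension by at most `|S|`. -/
theorem finrank_le_finrank_add_card {F V ι : Type*} [Field F] [AddCommGroup V] [Module F V]
    [FiniteDimensional F V] (U W : Submodule F V) (S : Finset ι) (φ : ι → V →ₗ[F] F)
    (h : ∀ x ∈ W, (∀ i ∈ S, φ i x = 0) → x ∈ U) :
    Module.finrank F W ≤ Module.finrank F U + S.card := by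
  let Φ : W →ₗ[F] (S → F) := (LinearMap.pi fun i : S => φ i).comp W.subtype
  have h1 := Φ.finrank_range_add_finrank_ker
  have h2 : Module.finrank F (LinearMap.range Φ) ≤ S.card := by
    simpa using (LinearMap.range Φ).finrank_le
  have h3 : Module.finrank F (LinearMap.ker Φ) ≤ Module.finrank F U := by
    rw [(Submodule.equivMapOfInjective W.subtype W.subtype_injective
      (LinearMap.ker Φ)).finrank_eq]
    refine Submodule.finrank_mono ?_
    rintro _ ⟨x, hx, rfl⟩
    exact h x x.2 fun i hi => congrFun (LinearMap.mem_ker.1 hx) ⟨i, hi⟩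
  omega

/-! ### Gabidulin codes and the minimum distance of the composite code -/

/-- Linearized polynomials over `L` are `F`-linear maps. -/
theorem sum_smul_pow_card {F : Type u} {L : Type v} [Field F] [Finite F] [Field L] [Algebra F L]
    {l : ℕ} (p : Fin l → L) (y : Fin l → F) (i : ℕ) :
    (∑ j, y j • p j) ^ (Nat.card F ^ i) = ∑ j, y j • p j ^ (Nat.card F ^ i) := by
  have := Fintype.ofFinite F
  have h : ∀ x : L, (FiniteField.frobeniusAlgHom F L ^ i) x = x ^ (Nat.card F ^ i) := by
    intro x
    rw [AlgHom.coe_pow, FiniteField.coe_frobeniusAlgHom, pow_iterate, Nat.card_eq_fintype_card]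
  simp only [← h, map_sum, map_smul]

/-- The values at an `F`-combination `y` of the points: a linearized polynomial with coefficients
`a` maps `∑ j, y j • p j` to the corresponding combination of the word of `a`. -/
theorem gabidulinEncode_dotProduct {F : Type u} {L : Type v} [Field F] [Finite F] [Field L]
    [Algebra F L] {l k : ℕ} (p : Fin l → L) (a : Fin k → L) (y : Fin l → F) :
    ∑ j, gabidulinEncode F p k a j * algebraMap F L (y j) =
      ∑ i : Fin k, a i * (∑ j, y j • p j) ^ (Nat.card F ^ (i : ℕ)) := by
  simp only [sum_smul_pow_card, gabidulinEncode, LinearMap.coe_mk, AddHom.coe_mk, Finset.sum_mul,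
    Finset.mul_sum]
  rw [Finset.sum_comm]
  refine Finset.sum_congr rfl fun i _ => Finset.sum_congr rfl fun j _ => ?_
  rw [Algebra.smul_def]
  ring

/-- A nonzero linearized polynomial of `q`-degree less than `k` vanishes on an `F`-space of dimension
less than `k` only, since it has at most `q ^ (k - 1)` roots. -/
theorem finrank_lt_of_linearized_vanish {F : Type u} {L : Type v} [Field F] [Finite F] [Field L]
    [Algebra F L] {l k : ℕ} {p : Fin l → L} (hp : LinearIndependent F p) {a : Fin k → L}
    (ha : a ≠ 0) (W : Submodule F (Fin l → F))
    (hW : ∀ y ∈ W, ∑ i : Fin k, a i * (∑ j, y j • p j) ^ (Nat.card F ^ (i : ℕ)) = 0) :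
    Module.finrank F W < k := by
  classical
  obtain ⟨i₀, hi₀⟩ := Function.ne_iff.1 ha
  have hq : 1 < Nat.card F := Finite.one_lt_card
  let P : Polynomial L :=
    ∑ i : Fin k, Polynomial.C (a i) * Polynomial.X ^ (Nat.card F ^ (i : ℕ))
  have hcoeff : P.coeff (Nat.card F ^ (i₀ : ℕ)) = a i₀ := by
    simp only [P, Polynomial.finsetSum_coeff, Polynomial.coeff_C_mul, Polynomial.coeff_X_pow]
    rw [Finset.sum_eq_single i₀]
    · simp
    · intro b _ hb
      have : Nat.card F ^ (i₀ : ℕ) ≠ Nat.card F ^ (b : ℕ) := fun h =>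
        hb (Fin.ext (Nat.pow_right_injective hq h).symm)
      simp [this]
    · simp
  have hP : P ≠ 0 := fun h => hi₀ (by rw [← hcoeff, h]; simp)
  have hdeg : P.natDegree ≤ Nat.card F ^ (k - 1) := by
    refine Polynomial.natDegree_sum_le_of_forall_le _ _ fun i _ => ?_
    refine (Polynomial.natDegree_C_mul_X_pow_le _ _).trans ?_
    exact Nat.pow_le_pow_right hq.le (by omega)
  have hcard : Nat.card W ≤ P.natDegree := by
    have hmem : ∀ y : W, (∑ j, y.1 j • p j) ∈ P.roots.toFinset := by
      intro y
      rw [Multiset.mem_toFinset, Polynomial.mem_roots hP, Polynomial.IsRoot]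
      simpa [P, Polynomial.eval_finsetSum] using hW y y.2
    have hinj : Function.Injective fun y : W =>
        (⟨∑ j, y.1 j • p j, hmem y⟩ : P.roots.toFinset) := by
      intro y z hyz
      refine Subtype.ext (hp.fintypeLinearCombination_injective ?_)
      simpa [Fintype.linearCombination_apply] using hyz
    calc Nat.card W ≤ Nat.card P.roots.toFinset := Nat.card_le_card_of_injective _ hinj
      _ = P.roots.toFinset.card := by rw [Nat.card_eq_fintype_card, Fintype.card_coe]
      _ ≤ P.roots.card := Multiset.toFinset_card_le _
      _ ≤ P.natDegree := P.card_roots'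
  rw [Module.natCard_eq_pow_finrank (K := F)] at hcard
  have := (Nat.pow_le_pow_iff_right hq).1 (hcard.trans hdeg)
  have := i₀.2
  omega

/-- The words of `D` whose support lies in `T`. -/
def supportedIn {n : ℕ} {F : Type u} [Field F] (D : Submodule F (Fin n → F))
    (T : Finset (Fin n)) : Submodule F (Fin n → F) where
  carrier := {x | x ∈ D ∧ ∀ i ∉ T, x i = 0}
  add_mem' h h' := ⟨D.add_mem h.1 h'.1, fun i hi => by simp [h.2 i hi, h'.2 i hi]⟩
  zero_mem' := ⟨D.zero_mem, fun _ _ => rfl⟩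
  smul_mem' a x h := ⟨D.smul_mem a h.1, fun i hi => by simp [h.2 i hi]⟩

theorem supportedIn_empty {n : ℕ} {F : Type u} [Field F] (D : Submodule F (Fin n → F)) :
    supportedIn D ∅ = ⊥ :=
  (Submodule.eq_bot_iff _).2 fun _ hx => funext fun i => hx.2 i (Finset.notMem_empty i)

theorem IsGeneratorMatrix.finrank_eq {n l : ℕ} {F : Type u} [Field F]
    {A : Matrix (Fin l) (Fin n) F} {D : Submodule F (Fin n → F)} (hA : IsGeneratorMatrix A D) :
    Module.finrank F D = l := by
  rw [← hA.2, finrank_span_eq_card hA.1, Fintype.card_fin]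

/-- The maximum rank distance property of Gabidulin codes, after the inner encoding: if the word of
a nonzero `a` vanishes off `T`, then the columns of `A` off `T` have rank less than `k`, and the
vectors `y` orthogonal to these columns encode the words of `D` supported in `T`. -/
theorem IsGeneratorMatrix.lt_add_finrank_supportedIn {F : Type u} {L : Type v} [Field F] [Finite F]
    [Field L] [Algebra F L] {n l k : ℕ} {A : Matrix (Fin l) (Fin n) F}
    {D : Submodule F (Fin n → F)} (hA : IsGeneratorMatrix A D) {p : Fin l → L}
    (hp : LinearIndependent F p) {a : Fin k → L} (ha : a ≠ 0) (T : Finset (Fin n))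
    (hT : ∀ i ∉ T, (A.map (algebraMap F L)).vecMulLinear (gabidulinEncode F p k a) i = 0) :
    l < k + Module.finrank F (supportedIn D T) := by
  let B : Matrix (Fin l) {i // i ∉ T} F := A.submatrix id Subtype.val
  have h1 : Module.finrank F (LinearMap.range B.mulVecLin) < k := by
    refine finrank_lt_of_linearized_vanish hp ha _ ?_
    rintro _ ⟨z, rfl⟩
    rw [← gabidulinEncode_dotProduct]
    have h : ∀ i : {i // i ∉ T}, ∑ j, gabidulinEncode F p k a j * algebraMap F L (A j i) = 0 :=
      fun i => by simpa [Matrix.vecMul, dotProduct] using hT i i.2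
    calc ∑ j, gabidulinEncode F p k a j * algebraMap F L (B.mulVecLin z j)
        = ∑ i : {i // i ∉ T}, (∑ j, gabidulinEncode F p k a j * algebraMap F L (A j i)) *
            algebraMap F L (z i) := by
          simp only [Matrix.mulVecLin_apply, Matrix.mulVec, dotProduct, map_sum, map_mul,
            Finset.mul_sum, Finset.sum_mul, B, Matrix.submatrix_apply, id]
          rw [Finset.sum_comm]
          simp only [mul_assoc]
      _ = 0 := by simp [h]
  have h2 : Module.finrank F (LinearMap.range B.vecMulLinear) =
      Module.finrank F (LinearMap.range B.mulVecLin) := by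
    rw [← Matrix.mulVecLin_transpose]
    exact B.rank_transpose
  have h3 := B.vecMulLinear.finrank_range_add_finrank_ker
  rw [Module.finrank_fin_fun] at h3
  have hinj : Function.Injective A.vecMulLinear := Matrix.vecMul_injective_iff.2 hA.1
  have h4 : Module.finrank F (LinearMap.ker B.vecMulLinear) ≤
      Module.finrank F (supportedIn D T) := by
    rw [(Submodule.equivMapOfInjective A.vecMulLinear hinj _).finrank_eq]
    refine Submodule.finrank_mono ?_
    rintro _ ⟨y, hy, rfl⟩
    refine ⟨?_, fun i hi => congrFun (LinearMap.mem_ker.1 hy) ⟨i, hi⟩⟩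
    rw [← hA.2, ← range_vecMulLinear]
    exact LinearMap.mem_range_self _ y
  omega

/-- The encoder of the composite code is injective. -/
theorem IsGeneratorMatrix.gabidulinThen_injective {F : Type u} {L : Type v} [Field F] [Finite F]
    [Field L] [Algebra F L] {n l k : ℕ} {A : Matrix (Fin l) (Fin n) F}
    {D : Submodule F (Fin n → F)} (hA : IsGeneratorMatrix A D) {p : Fin l → L}
    (hp : LinearIndependent F p) (hk : k ≤ l) :
    Function.Injective ((A.map (algebraMap F L)).vecMulLinear ∘ₗ gabidulinEncode F p k) := by
  rw [← LinearMap.ker_eq_bot, LinearMap.ker_eq_bot']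
  intro a h0
  by_contra ha
  have h := hA.lt_add_finrank_supportedIn hp ha ∅ fun i _ => congrFun h0 i
  rw [supportedIn_empty, finrank_bot] at h
  omega

theorem IsGeneratorMatrix.finrank_gabidulinThen {F : Type u} {L : Type v} [Field F] [Finite F]
    [Field L] [Algebra F L] {n l k : ℕ} {A : Matrix (Fin l) (Fin n) F}
    {D : Submodule F (Fin n → F)} (hA : IsGeneratorMatrix A D) {p : Fin l → L}
    (hp : LinearIndependent F p) (hk : k ≤ l) :
    Module.finrank L (gabidulinThen p k A) = k := by
  rw [gabidulinThen, ← LinearMap.range_comp,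
    LinearMap.finrank_range_of_inj (hA.gabidulinThen_injective hp hk), Module.finrank_fin_fun]

/-- A word of minimum weight in the composite code has as support a set `T` of `d` coordinates on
which the inner code `D` has at least `l - k + 1` dimensions of words. -/
theorem IsGeneratorMatrix.exists_card_eq_minDistance {F : Type u} {L : Type v} [Field F] [Finite F]
    [Field L] [Algebra F L] {n l k : ℕ} {A : Matrix (Fin l) (Fin n) F}
    {D : Submodule F (Fin n → F)} (hA : IsGeneratorMatrix A D) {p : Fin l → L}
    (hp : LinearIndependent F p) (hk₁ : 1 ≤ k) (hk : k ≤ l) :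
    ∃ T : Finset (Fin n), T.card = minDistance (gabidulinThen p k A) ∧
      l < k + Module.finrank F (supportedIn D T) := by
  classical
  have hne : gabidulinThen p k A ≠ ⊥ := by
    intro h
    have := hA.finrank_gabidulinThen hp hk
    rw [h, finrank_bot] at this
    omega
  obtain ⟨x₀, hx₀, hx₀'⟩ := Submodule.exists_mem_ne_zero_of_ne_bot hne
  obtain ⟨x, hx, hx', hd⟩ := Nat.sInf_mem
    (s := {d | ∃ x ∈ gabidulinThen p k A, x ≠ 0 ∧ hammingNorm x = d}) ⟨_, x₀, hx₀, hx₀', rfl⟩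
  obtain ⟨_, ⟨a, rfl⟩, rfl⟩ := hx
  refine ⟨Finset.univ.filter fun i =>
    (A.map (algebraMap F L)).vecMulLinear (gabidulinEncode F p k a) i ≠ 0, ?_,
    hA.lt_add_finrank_supportedIn hp (a := a) ?_ _ ?_⟩
  · rw [minDistance]
    rw [← hd, hammingNorm]
  · rintro rfl
    simp at hx'
  · intro i hi
    simpa only [Finset.mem_filter, Finset.mem_univ, true_and, not_not] using hi

/-! ### The corank of random matrices on a matching -/

/-- If a coordinate of `w` can be changed without affecting `Φ`, and at most one of its values gives
`Ψ = Φ + 1`, then the mean of `|X| ^ Ψ` is at most twice the mean of `|X| ^ Φ`. -/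
theorem sum_card_pow_le_two_mul {E X : Type*} [Fintype E] [DecidableEq E] [Fintype X] (e : E)
    (Φ Ψ : (E → X) → ℕ) (hΦ : ∀ w x, Φ (Function.update w e x) = Φ w) (hle : ∀ w, Ψ w ≤ Φ w + 1)
    (huniq : ∀ w x, Φ w < Ψ w → Φ w < Ψ (Function.update w e x) → x = w e) :
    ∑ w, Fintype.card X ^ Ψ w ≤ 2 * ∑ w, Fintype.card X ^ Φ w := by
  classical
  rcases isEmpty_or_nonempty X with hX | hX
  · have : IsEmpty (E → X) := ⟨fun w => hX.elim (w e)⟩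
    simp
  -- Changing the coordinate `e` is injective on `R × X`, since each fibre meets `R` at most once.
  let R : Finset (E → X) := Finset.univ.filter fun w => Φ w < Ψ w
  have hinj : Set.InjOn (fun y : (E → X) × X => Function.update y.1 e y.2)
      (R ×ˢ (Finset.univ : Finset X) : Finset _) := by
    rintro ⟨w, x⟩ hw ⟨w', x'⟩ hw' heq
    simp only [R, Finset.coe_product, Set.mem_prod, Finset.mem_coe, Finset.mem_filter,
      Finset.mem_univ, true_and, and_true] at hw hw' heq
    have hx : x = x' := by simpa using congrFun heq e
    have hw2 : w' = Function.update w e (w' e) := by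
      rw [← Function.update_idem x' (w' e) w, ← hx, heq, Function.update_idem,
        Function.update_eq_self]
    have hv := huniq w (w' e) hw (by rw [← hw2]; rwa [hw2, hΦ, ← hw2] at hw')
    rw [hv, Function.update_eq_self] at hw2
    rw [hw2, hx]
  have h1 : ∑ w ∈ R, Fintype.card X * Fintype.card X ^ Φ w ≤ ∑ w, Fintype.card X ^ Φ w := by
    calc ∑ w ∈ R, Fintype.card X * Fintype.card X ^ Φ w
        = ∑ y ∈ R ×ˢ (Finset.univ : Finset X),
            Fintype.card X ^ Φ (Function.update y.1 e y.2) := by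
          rw [Finset.sum_product]
          simp [hΦ]
      _ = ∑ w ∈ (R ×ˢ (Finset.univ : Finset X)).image
            (fun y : (E → X) × X => Function.update y.1 e y.2), Fintype.card X ^ Φ w :=
          (Finset.sum_image hinj (f := fun w => Fintype.card X ^ Φ w)).symm
      _ ≤ _ := Finset.sum_le_sum_of_subset (Finset.subset_univ _)
  have h2 : ∀ w, Fintype.card X ^ Ψ w ≤ Fintype.card X ^ Φ w +
      if Φ w < Ψ w then Fintype.card X * Fintype.card X ^ Φ w else 0 := by
    intro w
    split_ifs with h
    · have : Ψ w = Φ w + 1 := le_antisymm (hle w) h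
      rw [this, pow_succ']
      exact Nat.le_add_left _ _
    · exact Nat.pow_le_pow_right Fintype.card_pos (not_lt.1 h)
  calc ∑ w, Fintype.card X ^ Ψ w
      ≤ ∑ w, (Fintype.card X ^ Φ w +
        if Φ w < Ψ w then Fintype.card X * Fintype.card X ^ Φ w else 0) :=
        Finset.sum_le_sum fun w _ => h2 w
    _ = ∑ w, Fintype.card X ^ Φ w + ∑ w ∈ R, Fintype.card X * Fintype.card X ^ Φ w := by
        rw [Finset.sum_add_distrib, Finset.sum_filter]
    _ ≤ _ := by omega

open Classical in
theorem parityCheck_update {n c : ℕ} {F : Type u} [Field F] {G : SimpleGraph (Fin n ⊕ Fin c)}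
    (w : G.edgeSet → Fˣ) {i₀ : Fin n} {j₀ : Fin c} (h₀ : s(Sum.inl i₀, Sum.inr j₀) ∈ G.edgeSet)
    (u : Fˣ) (j : Fin c) (i : Fin n) :
    parityCheck G (Function.update w ⟨_, h₀⟩ u) j i =
      if j = j₀ ∧ i = i₀ then (u : F) else parityCheck G w j i := by
  by_cases hji : j = j₀ ∧ i = i₀
  · obtain ⟨rfl, rfl⟩ := hji
    simp [parityCheck, (G.mem_edgeSet).1 h₀]
  · rw [if_neg hji]
    simp only [parityCheck, Matrix.of_apply]
    split_ifs with h
    · rw [Function.update_of_ne]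
      intro he
      have := congrArg Subtype.val he
      simp only [Sym2.eq_iff, Sum.inl.injEq, Sum.inr.injEq, reduceCtorEq, and_self, or_false]
        at this
      exact hji ⟨this.2, this.1⟩
    · rfl

open Classical in
theorem parityCheck_update_mulVec {n c : ℕ} {F : Type u} [Field F]
    {G : SimpleGraph (Fin n ⊕ Fin c)} (w : G.edgeSet → Fˣ) {i₀ : Fin n} {j₀ : Fin c}
    (h₀ : s(Sum.inl i₀, Sum.inr j₀) ∈ G.edgeSet) (u : Fˣ) (x : Fin n → F) (j : Fin c) :
    (parityCheck G (Function.update w ⟨_, h₀⟩ u)).mulVec x j =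
      (parityCheck G w).mulVec x j + if j = j₀ then ((u : F) - w ⟨_, h₀⟩) * x i₀ else 0 := by
  have hw : parityCheck G w j₀ i₀ = w ⟨_, h₀⟩ := by simp [parityCheck, (G.mem_edgeSet).1 h₀]
  simp only [Matrix.mulVec, dotProduct, parityCheck_update w h₀]
  split_ifs with hj
  · subst hj
    rw [← hw, ← sub_eq_iff_eq_add', ← Finset.sum_sub_distrib, Finset.sum_eq_single i₀]
    · simp [sub_mul]
    · intro b _ hb
      simp [hb]
    · simp
  · simp [hj]

/-- The words supported in `S` that satisfy the parity checks in `R`: the kernel of the submatrix of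
the parity-check matrix with columns `S` and rows `R`. -/
def partialCode {n c : ℕ} {F : Type u} [Field F] (G : SimpleGraph (Fin n ⊕ Fin c))
    (w : G.edgeSet → Fˣ) (S : Finset (Fin n)) (R : Set (Fin c)) : Submodule F (Fin n → F) where
  carrier := {x | (∀ i ∉ S, x i = 0) ∧ ∀ j ∈ R, (parityCheck G w).mulVec x j = 0}
  add_mem' h h' := ⟨fun i hi => by simp [h.1 i hi, h'.1 i hi],
    fun j hj => by simp [Matrix.mulVec_add, h.2 j hj, h'.2 j hj]⟩
  zero_mem' := ⟨fun _ _ => rfl, fun _ _ => by simp⟩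
  smul_mem' a x h := ⟨fun i hi => by simp [h.1 i hi],
    fun j hj => by simp [Matrix.mulVec_smul, h.2 j hj]⟩

theorem partialCode_empty {n c : ℕ} {F : Type u} [Field F] (G : SimpleGraph (Fin n ⊕ Fin c))
    (w : G.edgeSet → Fˣ) (R : Set (Fin c)) : partialCode G w ∅ R = ⊥ :=
  (Submodule.eq_bot_iff _).2 fun _ hx => funext fun i => hx.1 i (Finset.notMem_empty i)

theorem supportedIn_expanderCode_le {n c : ℕ} {F : Type u} [Field F]
    {G : SimpleGraph (Fin n ⊕ Fin c)} (w : G.edgeSet → Fˣ) (S : Finset (Fin n)) (R : Set (Fin c)) :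
    supportedIn (expanderCode G w) S ≤ partialCode G w S R :=
  fun _ hx => ⟨hx.2, fun j _ => congrFun (LinearMap.mem_ker.1 hx.1) j⟩

/-- One step of the exposure of the matched edges: when `i₀` and its partner `f i₀` are added to the
square submatrix on `T` and `f '' T`, the corank rises (by one) for at most one value of the weight
of the edge between them. For if it rises, some `x` supported in `insert i₀ T` satisfies the old
checks, has `x i₀ ≠ 0`, and satisfies the new check; the latter determines the weight. -/
theorem sum_card_pow_finrank_insert_le {n c : ℕ} {F : Type u} [Field F] [Finite F]
    {G : SimpleGraph (Fin n ⊕ Fin c)} {T : Finset (Fin n)} {i₀ : Fin n} (hi₀ : i₀ ∉ T)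
    {f : Fin n → Fin c} (hf : ∀ i ∈ T, f i ≠ f i₀) (hadj : G.Adj (Sum.inl i₀) (Sum.inr (f i₀)))
    [Fintype (G.edgeSet → Fˣ)] :
    ∑ w : G.edgeSet → Fˣ, Nat.card Fˣ ^
        Module.finrank F (partialCode G w (insert i₀ T) (f '' (insert i₀ T : Finset (Fin n)))) ≤
      2 * ∑ w : G.edgeSet → Fˣ, Nat.card Fˣ ^ Module.finrank F (partialCode G w T (f '' T)) := by
  classical
  have := Fintype.ofFinite F
  have h₀ : s(Sum.inl i₀, Sum.inr (f i₀)) ∈ G.edgeSet := hadj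
  have hne : ∀ j ∈ f '' (T : Set (Fin n)), j ≠ f i₀ := by
    rintro _ ⟨i, hi, rfl⟩
    exact hf i hi
  have hup : ∀ (S : Finset (Fin n)) (w : G.edgeSet → Fˣ) (u : Fˣ),
      partialCode G (Function.update w ⟨_, h₀⟩ u) S (f '' T) =
      partialCode G w S (f '' T) := by
    intro S w u
    ext x
    refine and_congr_right fun _ => forall₂_congr fun j hj => ?_
    rw [parityCheck_update_mulVec, if_neg (hne j hj), add_zero]
  have hle₁ : ∀ w : G.edgeSet → Fˣ,
      partialCode G w (insert i₀ T) (f '' (insert i₀ T : Finset (Fin n))) ≤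
      partialCode G w (insert i₀ T) (f '' T) := fun w x hx =>
    ⟨hx.1, fun j hj => hx.2 j (Set.image_mono (by simp) hj)⟩
  have hle₂ : ∀ w : G.edgeSet → Fˣ,
      Module.finrank F (partialCode G w (insert i₀ T) (f '' T)) ≤
      Module.finrank F (partialCode G w T (f '' T)) + 1 := fun w => by
    refine finrank_le_finrank_add_card _ _ {i₀} (fun i => LinearMap.proj i) fun x hx h => ⟨?_, hx.2⟩
    intro i hi
    by_cases hii : i = i₀
    · subst hii
      exact h i (Finset.mem_singleton_self i)
    · exact hx.1 i (by simp [hi, hii])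
  have hrise : ∀ w : G.edgeSet → Fˣ,
      Module.finrank F (partialCode G w T (f '' T)) < Module.finrank F
      (partialCode G w (insert i₀ T) (f '' (insert i₀ T : Finset (Fin n)))) →
      (∀ x ∈ partialCode G w (insert i₀ T) (f '' T),
        (parityCheck G w).mulVec x (f i₀) = 0) ∧
      ∃ x ∈ partialCode G w (insert i₀ T) (f '' T), x i₀ ≠ 0 := by
    intro w hw
    constructor
    · have heq := Submodule.eq_of_le_of_finrank_le (hle₁ w) ((hle₂ w).trans hw)
      intro x hx
      rw [← heq] at hx
      exact hx.2 _ ⟨i₀, by simp, rfl⟩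
    · by_contra! hall
      refine absurd hw (not_lt.2 (Submodule.finrank_mono fun x hx => ?_))
      have hx' := hle₁ w hx
      refine ⟨fun i hi => ?_, hx'.2⟩
      by_cases hii : i = i₀
      · subst hii
        exact hall x hx'
      · exact hx.1 i (by simp [hi, hii])
  have hmain := sum_card_pow_le_two_mul (X := Fˣ) (⟨_, h₀⟩ : G.edgeSet)
    (fun w => Module.finrank F (partialCode G w T (f '' T)))
    (fun w => Module.finrank F
      (partialCode G w (insert i₀ T) (f '' (insert i₀ T : Finset (Fin n)))))
    (fun w u => by rw [hup]) (fun w => (Submodule.finrank_mono (hle₁ w)).trans (hle₂ w)) (by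
      intro w u hw hu
      rw [← hup T w u] at hu
      obtain ⟨h1, -⟩ := hrise _ hu
      obtain ⟨h2, x, hx, hx0⟩ := hrise _ hw
      have h3 := h1 x (by rwa [hup])
      rw [parityCheck_update_mulVec, h2 x hx, if_pos rfl, zero_add] at h3
      exact Units.ext (sub_eq_zero.1 ((mul_eq_zero.1 h3).resolve_right hx0)))
  rw [Nat.card_eq_fintype_card]
  convert hmain

/-- The exponential moment of the corank of the random square matrix on a matching: its mean is at
most `2 ^ |T|`. -/
theorem sum_card_pow_finrank_le {n c : ℕ} {F : Type u} [Field F] [Finite F]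
    {G : SimpleGraph (Fin n ⊕ Fin c)} [Fintype (G.edgeSet → Fˣ)] (f : Fin n → Fin c)
    (T : Finset (Fin n)) (hf : Set.InjOn f T)
    (hadj : ∀ i ∈ T, G.Adj (Sum.inl i) (Sum.inr (f i))) :
    ∑ w : G.edgeSet → Fˣ, Nat.card Fˣ ^ Module.finrank F (partialCode G w T (f '' T)) ≤
      2 ^ T.card * Nat.card (G.edgeSet → Fˣ) := by
  induction T using Finset.induction_on with
  | empty =>
    refine (Finset.sum_le_sum fun w _ => (?_ : _ ≤ 1)).trans ?_
    · rw [partialCode_empty, finrank_bot, pow_zero]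
    · simp
  | insert i T hi ih =>
    have h1 := sum_card_pow_finrank_insert_le (F := F) hi (f := f)
      (fun j hj h => hi (hf (by simp [hj]) (by simp) h ▸ hj)) (hadj i (by simp))
    have h2 := ih (hf.mono (by simp)) fun j hj => hadj j (by simp [hj])
    rw [Finset.card_insert_of_notMem hi, pow_succ', mul_assoc]
    exact h1.trans (Nat.mul_le_mul_left 2 h2)

/-- Markov's inequality for the exponential moment of the corank. -/
theorem card_pow_mul_ncard_le {n c : ℕ} {F : Type u} [Field F] [Finite F]
    {G : SimpleGraph (Fin n ⊕ Fin c)} (f : Fin n → Fin c)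
    (T : Finset (Fin n)) (hf : Set.InjOn f T)
    (hadj : ∀ i ∈ T, G.Adj (Sum.inl i) (Sum.inr (f i))) (s : ℕ) :
    Nat.card Fˣ ^ s * {w : G.edgeSet → Fˣ |
        s ≤ Module.finrank F (supportedIn (expanderCode G w) T)}.ncard ≤
      2 ^ T.card * Nat.card (G.edgeSet → Fˣ) := by
  classical
  have := Fintype.ofFinite (G.edgeSet → Fˣ)
  refine le_trans ?_ (sum_card_pow_finrank_le (F := F) f T hf hadj)
  rw [Set.ncard_eq_toFinset_card', mul_comm, ← smul_eq_mul, ← Finset.sum_const]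
  refine (Finset.sum_le_sum fun w hw => ?_).trans
    (Finset.sum_le_sum_of_subset (Finset.subset_univ _))
  refine Nat.pow_le_pow_right Nat.card_pos ?_
  exact (Set.mem_toFinset.1 hw).trans
    (Submodule.finrank_mono (supportedIn_expanderCode_le w T _))

/-- `T ⊆ V` can be matched into `C` along the edges of `G`. -/
def IsMatchable {n c : ℕ} (G : SimpleGraph (Fin n ⊕ Fin c)) (T : Finset (Fin n)) : Prop :=
  ∃ f : T → Fin c, Function.Injective f ∧ ∀ i : T, G.Adj (Sum.inl (i : Fin n)) (Sum.inr (f i))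

theorem IsMatchable.exists_injOn {n c : ℕ} {G : SimpleGraph (Fin n ⊕ Fin c)} {T : Finset (Fin n)}
    (h : IsMatchable G T) (hT : T.Nonempty) : ∃ f : Fin n → Fin c, Set.InjOn f T ∧
      ∀ i ∈ T, G.Adj (Sum.inl i) (Sum.inr (f i)) := by
  obtain ⟨f, hf, hadj⟩ := h
  obtain ⟨i₁, hi₁⟩ := hT
  classical
  refine ⟨fun i => if h : i ∈ T then f ⟨i, h⟩ else f ⟨i₁, hi₁⟩, ?_, ?_⟩
  · intro i hi j hj hij
    simp only [Finset.mem_coe] at hi hj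
    simp only [hi, hj, dif_pos] at hij
    exact congrArg Subtype.val (hf hij)
  · intro i hi
    simp only [hi, dif_pos]
    exact hadj ⟨i, hi⟩

/-- A union bound over the at most `2 ^ n` matchable sets: outside of a set of weights of proportion
`4 ^ n / (q - 1) ^ s`, every matchable set carries a space of codewords of dimension less than
`s`. -/
theorem card_pow_mul_ncard_exists_matchable_le {n c : ℕ} {F : Type u} [Field F] [Finite F]
    (G : SimpleGraph (Fin n ⊕ Fin c)) {s : ℕ} (hs : 0 < s) :
    Nat.card Fˣ ^ s * {w : G.edgeSet → Fˣ | ∃ T, IsMatchable G T ∧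
        s ≤ Module.finrank F (supportedIn (expanderCode G w) T)}.ncard ≤
      4 ^ n * Nat.card (G.edgeSet → Fˣ) := by
  classical
  let B : Finset (Fin n) → Set (G.edgeSet → Fˣ) := fun T =>
    {w | IsMatchable G T ∧ s ≤ Module.finrank F (supportedIn (expanderCode G w) T)}
  have hB : ∀ T, Nat.card Fˣ ^ s * (B T).ncard ≤ 2 ^ n * Nat.card (G.edgeSet → Fˣ) := by
    intro T
    by_cases hT : IsMatchable G T
    · rcases T.eq_empty_or_nonempty with rfl | hne
      · have : B ∅ = ∅ := by
          refine Set.eq_empty_of_forall_notMem fun w hw => ?_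
          have := hw.2
          rw [supportedIn_empty, finrank_bot] at this
          omega
        simp [this]
      · obtain ⟨f, hf, hadj⟩ := hT.exists_injOn hne
        simp only [B, hT, true_and]
        refine (card_pow_mul_ncard_le f T hf hadj s).trans (Nat.mul_le_mul_right _ ?_)
        exact Nat.pow_le_pow_right two_pos (T.card_le_univ.trans_eq (Fintype.card_fin n))
    · simp [B, hT]
  have hU : {w : G.edgeSet → Fˣ | ∃ T, IsMatchable G T ∧
      s ≤ Module.finrank F (supportedIn (expanderCode G w) T)} =
      ⋃ T ∈ (Finset.univ : Finset (Finset (Fin n))), B T := by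
    ext w
    simp [B]
  rw [hU]
  calc _ ≤ Nat.card Fˣ ^ s * ∑ T : Finset (Fin n), (B T).ncard :=
        Nat.mul_le_mul_left _ (Finset.set_ncard_biUnion_le _ _)
    _ ≤ ∑ _T : Finset (Fin n), 2 ^ n * Nat.card (G.edgeSet → Fˣ) := by
        rw [Finset.mul_sum]
        exact Finset.sum_le_sum fun T _ => hB T
    _ = _ := by
        rw [Finset.sum_const, Finset.card_univ, Fintype.card_finset, Fintype.card_fin, smul_eq_mul,
          ← mul_assoc, ← mul_pow]
        norm_num

/-! ### Expansion and the rate bound -/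

/-- In an expander, the deficiency of a set of `d` vertices is at most `max (d (1 - κ)) 0`, up to the
slack in the size of the expanding sets: a larger set is cut down to the threshold size. -/
theorem IsExpander.card_le_ncard_neighbours_add {n c : ℕ} {G : SimpleGraph (Fin n ⊕ Fin c)}
    {α κ d b : ℝ} (hb : 0 ≤ b) (hα : α * n = d - b) (hG : IsExpander G α κ)
    (S : Finset (Fin n)) (hS : (S.card : ℝ) ≤ d) :
    (S.card : ℝ) ≤ (neighbours G S).ncard + (max (d * (1 - κ)) 0 + b + 1) := by
  have hmax := le_max_right (d * (1 - κ)) 0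
  have key : ∀ m : ℝ, 0 ≤ m → m ≤ d → m * (1 - κ) ≤ max (d * (1 - κ)) 0 := by
    intro m hm hmd
    rcases le_total 0 (1 - κ) with h | h
    · exact (mul_le_mul_of_nonneg_right hmd h).trans (le_max_left _ _)
    · exact (mul_nonpos_of_nonneg_of_nonpos hm h).trans hmax
  have small : ∀ S' : Finset (Fin n), (S'.card : ℝ) ≤ d - b →
      (S'.card : ℝ) ≤ (neighbours G S').ncard + max (d * (1 - κ)) 0 := by
    intro S' hS'
    rcases S'.eq_empty_or_nonempty with rfl | hne
    · simp only [Finset.card_empty, Nat.cast_zero]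
      positivity
    · have h1 := hG S' hne (hS'.trans_eq hα.symm)
      have h2 := key S'.card (Nat.cast_nonneg _) (by linarith)
      linarith
  rcases lt_or_ge (d - b) 0 with hneg | hpos
  · have : (0 : ℝ) ≤ (neighbours G S).ncard := Nat.cast_nonneg _
    linarith
  · rcases le_total (S.card : ℝ) (d - b) with h | h
    · linarith [small S h]
    · obtain ⟨S', hS'S, hS'⟩ := Finset.exists_subset_card_eq (s := S) (n := ⌊d - b⌋₊)
        (Nat.cast_le.1 ((Nat.floor_le hpos).trans h))
      have h1 := small S' (by rw [hS']; exact Nat.floor_le hpos)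
      have h2 : (neighbours G S').ncard ≤ (neighbours G S).ncard :=
        Set.ncard_le_ncard (fun j ⟨i, hi, hij⟩ => ⟨i, hS'S hi, hij⟩) (Set.toFinite _)
      have h2' : ((neighbours G S').ncard : ℝ) ≤ (neighbours G S).ncard := by exact_mod_cast h2
      have h3 := Nat.lt_floor_add_one (d - b)
      rw [hS'] at h1
      linarith

theorem exists_isMatchable_of_deficiency {n c : ℕ} (G : SimpleGraph (Fin n ⊕ Fin c))
    (T : Finset (Fin n)) (K : ℕ) (h : ∀ S ⊆ T, S.card ≤ (neighbours G S).ncard + K) :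
    ∃ T' ⊆ T, T.card ≤ T'.card + K ∧ IsMatchable G T' := by
  classical
  obtain ⟨T', hT', hc, f, hf, hfN⟩ := exists_matching_of_card_le_card_biUnion_add T
    (fun i => Finset.univ.filter fun j => G.Adj (Sum.inl i) (Sum.inr j)) K (by
      intro S hS
      refine (h S hS).trans_eq ?_
      rw [← Set.ncard_coe_finset]
      congr 2
      ext j
      simp [neighbours])
  exact ⟨T', hT', hc, f, hf, fun i => by simpa using hfN i⟩

theorem finrank_supportedIn_le {n : ℕ} {F : Type u} [Field F] (D : Submodule F (Fin n → F))
    {T T' : Finset (Fin n)} (h : T' ⊆ T) :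
    Module.finrank F (supportedIn D T) ≤
      Module.finrank F (supportedIn D T') + (T.card - T'.card) := by
  rw [← Finset.card_sdiff_of_subset h]
  refine finrank_le_finrank_add_card _ _ (T \ T') (fun i => LinearMap.proj i)
    fun x hx hi => ⟨hx.1, fun i hiT' => ?_⟩
  by_cases hiT : i ∈ T
  · exact hi i (Finset.mem_sdiff.2 ⟨hiT, hiT'⟩)
  · exact hx.2 i hiT

theorem le_finrank_expanderCode_add {n c : ℕ} {F : Type u} [Field F]
    (G : SimpleGraph (Fin n ⊕ Fin c)) (w : G.edgeSet → Fˣ) :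
    n ≤ Module.finrank F (expanderCode G w) + c := by
  have := finrank_le_finrank_add_card (expanderCode G w) ⊤ (Finset.univ : Finset (Fin c))
    (fun j => LinearMap.proj j ∘ₗ (parityCheck G w).mulVecLin)
    (fun x _ h => LinearMap.mem_ker.2 (funext fun j => h j (Finset.mem_univ j)))
  simpa using this

/-- The rate bound for weights that leave every matchable set with a space of at most `s` dimensions
of codewords. -/
theorem codeRate_ge_of_forall_matchable {n c t r s : ℕ} {G : SimpleGraph (Fin n ⊕ Fin c)}
    (hn : 0 < n) (hG : IsBiregularBipartite G t (r + 1)) {F : Type u} {L : Type v} [Field F]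
    [Finite F] [Field L] [Algebra F L] {w : G.edgeSet → Fˣ}
    (hw : ∀ T, IsMatchable G T → Module.finrank F (supportedIn (expanderCode G w) T) ≤ s)
    {l k : ℕ} {A : Matrix (Fin l) (Fin n) F} {p : Fin l → L}
    (hA : IsGeneratorMatrix A (expanderCode G w)) (hp : LinearIndependent F p) (hk₁ : 1 ≤ k)
    (hk : k ≤ l) {η κ : ℝ} (hη : 0 ≤ η)
    (hexp : IsExpander G (relDistance (gabidulinThen p k A) - η) κ) :
    1 - (t : ℝ) / (r + 1) - max (relDistance (gabidulinThen p k A) * (1 - κ)) 0 - η - s / n ≤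
      codeRate (gabidulinThen p k A) := by
  obtain ⟨T, hT, hlt⟩ := hA.exists_card_eq_minDistance hp hk₁ hk
  have hn' : (0 : ℝ) < n := by exact_mod_cast hn
  set δ := relDistance (gabidulinThen p k A) with hδ
  have hδn : δ * n = T.card := by
    rw [hδ, relDistance, ← hT, div_mul_cancel₀ _ hn'.ne']
  have hdef := hexp.card_le_ncard_neighbours_add (d := T.card) (b := η * n) (by positivity)
    (by rw [sub_mul, hδn])
  set Y : ℝ := max ((T.card : ℝ) * (1 - κ)) 0 + η * n + 1 with hY
  have hY0 : 0 ≤ Y := by positivity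
  obtain ⟨T', hT'T, hcard, hmat⟩ := exists_isMatchable_of_deficiency G T ⌊Y⌋₊ (by
    intro S hS
    have h1 := hdef S (by exact_mod_cast Finset.card_le_card hS)
    have h2 : S.card - (neighbours G S).ncard ≤ ⌊Y⌋₊ := by
      rw [Nat.le_floor_iff hY0]
      rcases le_total S.card (neighbours G S).ncard with h | h
      · simpa [Nat.sub_eq_zero_of_le h] using hY0
      · rw [Nat.cast_sub h]
        linarith
    omega)
  have h1 := finrank_supportedIn_le (expanderCode G w) hT'T
  have h2 := hw T' hmat
  have h3 := le_finrank_expanderCode_add G w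
  rw [hA.finrank_eq] at h3
  have h4 : n + 1 ≤ k + s + c + ⌊Y⌋₊ := by omega
  have h5 : (n : ℝ) + 1 ≤ k + s + c + Y := by
    have : (n : ℝ) + 1 ≤ k + s + c + ⌊Y⌋₊ := by exact_mod_cast h4
    linarith [Nat.floor_le hY0]
  have h6 : (c : ℝ) = t / (r + 1) * n := by
    have : (c : ℝ) * (r + 1) = n * t := by exact_mod_cast hG.card_mul_eq
    field_simp
    linarith
  have h7 : max ((T.card : ℝ) * (1 - κ)) 0 = max (δ * (1 - κ)) 0 * n := by
    rw [max_mul_of_nonneg _ _ hn'.le, zero_mul, ← hδn]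
    ring_nf
  rw [codeRate, hA.finrank_gabidulinThen hp hk, le_div_iff₀ hn']
  have h8 : (s : ℝ) / n * n = s := div_mul_cancel₀ _ hn'.ne'
  rw [hY, h7] at h5
  rw [h6] at h5
  nlinarith

theorem theorem3 (t r : ℕ) :
    ∀ ε : ℝ, 0 < ε → ∃ η : ℝ, 0 < η ∧ ∃ N Q : ℕ,
      ∀ (n c : ℕ) (G : SimpleGraph (Fin n ⊕ Fin c)), N ≤ n →
        IsBiregularBipartite G t (r + 1) → 4 < G.egirth →
      ∀ (F : Type u) [Field F] [Finite F], Q ≤ Nat.card F →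
        1 - ε ≤ uniformProb {w : G.edgeSet → Fˣ |
          ∀ (L : Type v) [Field L] [Algebra F L] [Module.Finite F L]
            (l : ℕ) (A : Matrix (Fin l) (Fin n) F) (p : Fin l → L) (k : ℕ),
            IsGeneratorMatrix A (expanderCode G w) → LinearIndependent F p →
            1 ≤ k → k ≤ l →
            ∀ δ γ : ℝ, δ = relDistance (gabidulinThen p k A) →
              IsExpander G (δ - η) (t * γ) →
              1 - (t : ℝ) / (r + 1) - max (δ * (1 - t * γ)) 0 - ε
                ≤ codeRate (gabidulinThen p k A)} := by
  intro ε hε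
  -- `M` and `Q` are such that `(q - 1) ^ (ε n / 2) ≥ 8 ^ n`.
  obtain ⟨M, hM⟩ := exists_nat_ge (2 / ε)
  obtain ⟨N, hN⟩ := exists_nat_ge (1 / ε)
  refine ⟨ε / 2, by positivity, N + 1, 8 ^ M + 1, ?_⟩
  intro n c G hNn hG _ F _ _ hQ
  have hn : 0 < n := by omega
  have hn' : (0 : ℝ) < n := by exact_mod_cast hn
  set s := ⌊ε / 2 * n⌋₊ with hs
  have hs_le : (s : ℝ) ≤ ε / 2 * n := Nat.floor_le (by positivity)
  let bad : Set (G.edgeSet → Fˣ) := {w | ∃ T, IsMatchable G T ∧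
    s + 1 ≤ Module.finrank F (supportedIn (expanderCode G w) T)}
  have hbad : ((bad.ncard : ℕ) : ℝ) ≤ ε * Nat.card (G.edgeSet → Fˣ) := by
    have h1 : Nat.card Fˣ ^ (s + 1) * bad.ncard ≤ 4 ^ n * Nat.card (G.edgeSet → Fˣ) :=
      card_pow_mul_ncard_exists_matchable_le G (Nat.succ_pos s)
    have h2 : 8 ^ M ≤ Nat.card Fˣ := by
      rw [Nat.card_units]
      omega
    have h3 : n ≤ M * (s + 1) := by
      have h4 : ε / 2 * n < s + 1 := Nat.lt_floor_add_one _
      have h5 : (n : ℝ) ≤ M * (s + 1) := by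
        calc (n : ℝ) = 2 / ε * (ε / 2 * n) := by field_simp
          _ ≤ M * (s + 1) := by gcongr
      exact_mod_cast h5
    have h4 : 8 ^ n ≤ Nat.card Fˣ ^ (s + 1) :=
      calc 8 ^ n ≤ 8 ^ (M * (s + 1)) := Nat.pow_le_pow_right (by norm_num) h3
        _ = (8 ^ M) ^ (s + 1) := pow_mul _ _ _
        _ ≤ _ := Nat.pow_le_pow_left h2 _
    have h5 : 4 ^ n * (2 ^ n * bad.ncard) ≤ 4 ^ n * Nat.card (G.edgeSet → Fˣ) := by
      rw [← mul_assoc, ← mul_pow]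
      exact (Nat.mul_le_mul_right _ h4).trans h1
    have h6 : 2 ^ n * bad.ncard ≤ Nat.card (G.edgeSet → Fˣ) :=
      Nat.le_of_mul_le_mul_left h5 (by positivity)
    have h7 : n * bad.ncard ≤ Nat.card (G.edgeSet → Fˣ) :=
      (Nat.mul_le_mul_right _ Nat.lt_two_pow_self.le).trans h6
    have h8 : (n : ℝ) * bad.ncard ≤ Nat.card (G.edgeSet → Fˣ) := by exact_mod_cast h7
    have h9 : 1 ≤ ε * n := by
      have : 1 / ε ≤ n := hN.trans (by exact_mod_cast (Nat.le_succ N).trans hNn)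
      rwa [div_le_iff₀' hε] at this
    calc (bad.ncard : ℝ) ≤ ε * n * bad.ncard := le_mul_of_one_le_left (Nat.cast_nonneg _) h9
      _ ≤ _ := by
        rw [mul_assoc]
        gcongr
  have hΩ : (0 : ℝ) < Nat.card (G.edgeSet → Fˣ) := by exact_mod_cast Nat.card_pos
  rw [uniformProb, le_div_iff₀ hΩ]
  have hgood : ((badᶜ.ncard : ℕ) : ℝ) = Nat.card (G.edgeSet → Fˣ) - bad.ncard := by
    have := Set.ncard_add_ncard_compl bad
    rw [← this]
    push_cast
    ring
  refine le_trans (b := ((badᶜ.ncard : ℕ) : ℝ)) (by rw [hgood]; linarith) ?_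
  refine Nat.cast_le.2 (Set.ncard_le_ncard ?_ (Set.toFinite _))
  rintro w hw L _ _ _ l A p k hA hp hk₁ hk δ γ rfl hexp
  have hmatch : ∀ T, IsMatchable G T →
      Module.finrank F (supportedIn (expanderCode G w) T) ≤ s := by
    intro T hT
    by_contra! h
    exact hw ⟨T, hT, h⟩
  have h := codeRate_ge_of_forall_matchable hn hG hmatch hA hp hk₁ hk (by positivity) hexp
  have hsn : (s : ℝ) / n ≤ ε / 2 := by rwa [div_le_iff₀ hn']
  linarith
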